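/- Let $\Theta\subseteq\mathbb R$ be an interval, and let $X$ be a random variable whose law, for each $\theta\in\Theta$, has a density (with respect to a fixed dominating measure, e.g. Lebesgue measure for a PDF or counting measure for a PMF) of the form $$f(x;\theta)=h(x)\exp[u(\theta)T(x)-v(\theta)],$$ where $h\ge 0$ and $T$ are measurable real-valued functions and $u,v$ are real-valued differentiable functions on $\Theta$ (with one-sided derivatives at an endpoint that belongs to $\Theta$) such that $v'(\theta)=\theta u'(\theta)$ and $u'(\theta)>0$ for all $\theta\in\Theta$. Let $X_1,X_2,\dots$ be i.i.d. samples of $X$, and let $f_n(x_1,\dots,x_n;\theta)=\prod_{i=1}^n f(x_i;\theta)$ be the likelihood function. Then for every integer $n\ge 1$ and all $x_1,\dots,x_n$ the function $\theta\mapsto f_n(x_1,\dots,x_n;\theta)$ is unimodal on $\Theta$, that is, there is a real number $\theta^*$ (not necessarily in $\Theta$) such that the function is non-decreasing on $\{\theta\in\Theta:\theta\le\theta^*\}$ and non-increasing on $\{\theta\in\Theta:\theta\ge\theta^*\}$. Moreover, for all $\alpha,\beta\in(0,1)$ and all $\theta,\theta',\theta''\in\Theta$ with $\theta'<\theta''$,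 $$\lim_{n\to\infty}\Pr\Bigl\{\beta<\Lambda_n(\theta',\theta'')<\tfrac1\alpha\,\Big|\,\theta\Bigr\}=0,$$ where $\Pr\{\cdot\mid\theta\}$ is the probability when the parameter is $\theta$, $\Lambda_n(\theta',\theta'')$ is the likelihood ratio $f_n(X_1,\dots,X_n;\theta'')/f_n(X_1,\dots,X_n;\theta')$, and the event is read as $\beta f_n(X_1,\dots,X_n;\theta')<f_n(X_1,\dots,X_n;\theta'')<\tfrac1\alpha f_n(X_1,\dots,X_n;\theta')$. -/

import Mathlib

/-- `g` is unimodal on the parameter set `Θ`: for some real number `θstar` (which need not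
belong to `Θ`), `g` is non-decreasing on the points of `Θ` that are at most `θstar` and
non-increasing on the points of `Θ` that are at least `θstar`. -/
def IsUnimodalOn (g : ℝ → ℝ) (Θ : Set ℝ) : Prop :=
  ∃ θstar : ℝ, MonotoneOn g (Θ ∩ Set.Iic θstar) ∧ AntitoneOn g (Θ ∩ Set.Ici θstar)

/-- The exponential-family density `f(x; θ) = h(x) exp[u(θ) T(x) - v(θ)]`. -/
noncomputable def expFamilyDensity {S : Type*} (h T : S → ℝ) (u v : ℝ → ℝ)
    (θ : ℝ) (x : S) : ℝ :=
  h x * Real.exp (u θ * T x - v θ)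

/-- The likelihood `f_n(x₁, …, x_n; θ)` of `n` independent observations with common density
`f(·; θ)`, i.e. the joint density, `∏ i, f(x_i; θ)`. -/
noncomputable def likelihood {S : Type*} (f : ℝ → S → ℝ) {n : ℕ} (x : Fin n → S) (θ : ℝ) : ℝ :=
  ∏ i, f θ (x i)

/-- `lo < Λ < hi` for the likelihood ratio `Λ = f_n(x; θ₂) / f_n(x; θ₁)`, where `Λ ∼ κ` is
read as `f_n(x; θ₂) ∼ κ f_n(x; θ₁)`, so that no division occurs. -/
def LikelihoodRatioBetween {S : Type*} (f : ℝ → S → ℝ) {n : ℕ} (x : Fin n → S)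
    (θ₁ θ₂ lo hi : ℝ) : Prop :=
  lo * likelihood f x θ₁ < likelihood f x θ₂ ∧ likelihood f x θ₂ < hi * likelihood f x θ₁

/-- `X 0, X 1, …` are i.i.d. samples whose common law has density `f` with respect to the
dominating measure `ν`, under the probability measure `P`. -/
structure IsIIDSample {Ω S : Type*} [MeasurableSpace Ω] [MeasurableSpace S]
    (ν : MeasureTheory.Measure S) (f : S → ℝ) (X : ℕ → Ω → S)
    (P : MeasureTheory.Measure Ω) : Prop where
  isProbabilityMeasure : MeasureTheory.IsProbabilityMeasure P
  measurable : ∀ i, Measurable (X i)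
  iIndepFun : ProbabilityTheory.iIndepFun X P
  map_eq : ∀ i, P.map (X i) = ν.withDensity (fun x => ENNReal.ofReal (f x))

open MeasureTheory ProbabilityTheory Filter
open scoped Topology

/-! With `t = ∑ T(x_i)`, the exponent of the likelihood has derivative `u'(θ) (t - nθ)`, whose sign
changes only at the sample mean of `T`; this gives unimodality.

The log-likelihood ratio is a sum of i.i.d. terms `(u θ₂ - u θ₁) T - (v θ₂ - v θ₁)`, and the event
confines it to a fixed bounded interval. If a summand has characteristic function `φ`, the
probability of that is at most a constant times the Gaussian average of `|φ|^n`
(`measure_abs_le_le_integral_norm_charFun`). For a non-degenerate summand `|φ| < 1` almost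
everywhere (`ae_norm_charFun_lt_one`), so dominated convergence gives the limit, with no moment
assumption. Non-degeneracy comes from normalisation: if `T = τ` almost surely, then `u τ - v` is
constant on `[θ₁, θ₂]`, so `u'(η) (τ - η) = 0` at each of its points. -/

/-- Anti-concentration via the Gaussian kernel. -/
theorem measure_abs_le_le_integral_norm_charFun {Ω : Type*} [MeasurableSpace Ω]
    (P : Measure Ω) [IsProbabilityMeasure P] {Z : Ω → ℝ} (hZ : Measurable Z) (M : ℝ) :
    P {ω | |Z ω| ≤ M} ≤ ENNReal.ofReal
      (Real.exp (M ^ 2 / 2) * ∫ t, ‖charFun (P.map Z) t‖ ∂(gaussianReal 0 1)) := by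
  have hm : IsProbabilityMeasure (P.map Z) := Measure.isProbabilityMeasure_map hZ.aemeasurable
  have key : (∫ z, Real.exp (-z ^ 2 / 2) ∂(P.map Z)) ≤
      ∫ t, ‖charFun (P.map Z) t‖ ∂(gaussianReal 0 1) := by
    have hint : Integrable (fun p : ℝ × ℝ => Complex.exp (p.1 * p.2 * Complex.I))
        ((gaussianReal 0 1).prod (P.map Z)) := by
      refine Integrable.of_bound (C := 1) (by fun_prop) (ae_of_all _ fun p => ?_)
      rw [← Complex.ofReal_mul, Complex.norm_exp_ofReal_mul_I]
    have h1 : ∫ t, charFun (P.map Z) t ∂(gaussianReal 0 1) =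
        ((∫ z, Real.exp (-z ^ 2 / 2) ∂(P.map Z) : ℝ) : ℂ) := by
      simp_rw [charFun_apply_real]
      rw [integral_integral_swap hint, ← integral_complex_ofReal]
      refine integral_congr_ae (ae_of_all _ fun z => ?_)
      -- After Fubini the inner integral is the characteristic function of the standard Gaussian,
      -- `exp(-z²/2)`.
      have := charFun_gaussianReal (μ := 0) (v := 1) z
      rw [charFun_apply_real] at this
      simp only [mul_comm (_ : ℂ) (z : ℂ)]
      rw [this]
      push_cast
      simp [neg_div]
    calc _ ≤ ‖((∫ z, Real.exp (-z ^ 2 / 2) ∂(P.map Z) : ℝ) : ℂ)‖ := by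
          rw [Complex.norm_real]; exact le_abs_self _
      _ ≤ _ := by rw [← h1]; exact norm_integral_le_integral_norm _
  rw [integral_map hZ.aemeasurable (by fun_prop)] at key
  have hmeas : MeasurableSet {ω | |Z ω| ≤ M} := measurableSet_le (by fun_prop) (by fun_prop)
  have hbd : P.real {ω | |Z ω| ≤ M} ≤ ∫ ω, Real.exp (M ^ 2 / 2) * Real.exp (-Z ω ^ 2 / 2) ∂P := by
    rw [← integral_indicator_one hmeas]
    refine integral_mono ((integrable_const 1).indicator hmeas) ?_ fun ω => ?_
    · refine Integrable.const_mul (Integrable.of_bound (C := 1) (by fun_prop)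
        (ae_of_all _ fun ω => ?_)) _
      rw [Real.norm_eq_abs, Real.abs_exp, Real.exp_le_one_iff]
      nlinarith [sq_nonneg (Z ω)]
    · by_cases hω : |Z ω| ≤ M
      · have : 1 ≤ Real.exp (M ^ 2 / 2) * Real.exp (-Z ω ^ 2 / 2) := by
          rw [← Real.exp_add, Real.one_le_exp_iff]
          have := sq_le_sq' (abs_le.1 hω).1 (abs_le.1 hω).2
          linarith
        simpa [Set.indicator, hω] using this
      · simp only [Set.indicator, Set.mem_ofPred_eq, hω, if_false]
        positivity
  rw [integral_const_mul] at hbd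
  rw [← ofReal_measureReal]
  exact ENNReal.ofReal_le_ofReal (hbd.trans (by gcongr))

/-- The characteristic function of a non-degenerate law has norm less than one almost
everywhere. -/
theorem ae_norm_charFun_lt_one (μ : Measure ℝ) [IsProbabilityMeasure μ]
    (hμ : ∀ c : ℝ, ¬ ∀ᵐ y ∂μ, y = c) (γ : Measure ℝ) [SFinite γ] [NullSingletonClass γ] :
    ∀ᵐ t ∂γ, ‖charFun μ t‖ < 1 := by
  -- For a fixed pair of distinct points the exceptional `t` are countably many, hence `γ`-null;
  -- Fubini exchanges the quantifiers.
  have hswap : ∀ᵐ t ∂γ, ∀ᵐ p : ℝ × ℝ ∂(μ.prod μ),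
      Complex.exp ((t * (p.1 - p.2) : ℝ) * Complex.I) = 1 → p.1 = p.2 := by
    rw [Measure.ae_ae_comm]
    · refine ae_of_all _ fun p => ?_
      by_cases hp : p.1 = p.2
      · simp [hp]
      · have hd : p.1 - p.2 ≠ 0 := sub_ne_zero.2 hp
        have hc : {t : ℝ | Complex.exp ((t * (p.1 - p.2) : ℝ) * Complex.I) = 1}.Countable := by
          refine (Set.countable_range (fun n : ℤ => n * (2 * Real.pi) / (p.1 - p.2))).mono ?_
          intro t ht
          obtain ⟨n, hn⟩ := Complex.exp_eq_one_iff.1 ht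
          refine ⟨n, ?_⟩
          rw [← mul_assoc (n : ℂ)] at hn
          have := mul_right_cancel₀ Complex.I_ne_zero hn
          rw [div_eq_iff hd]
          exact_mod_cast this.symm
        filter_upwards [hc.ae_notMem γ] with t ht h
        exact absurd h ht
    · have h1 : MeasurableSet {q : ℝ × ℝ × ℝ |
          Complex.exp ((q.1 * (q.2.1 - q.2.2) : ℝ) * Complex.I) = 1} :=
        measurableSet_eq_fun (by fun_prop) (by fun_prop)
      have h2 : MeasurableSet {q : ℝ × ℝ × ℝ | q.2.1 = q.2.2} :=
        measurableSet_eq_fun (by fun_prop) (by fun_prop)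
      exact h1.imp h2
  filter_upwards [hswap] with t ht
  have hle : ∀ᵐ y : ℝ ∂μ, ‖Complex.exp (t * y * Complex.I)‖ ≤ 1 := ae_of_all _ fun y => by
    rw [← Complex.ofReal_mul, Complex.norm_exp_ofReal_mul_I]
  rw [charFun_apply_real]
  -- By strict convexity, `‖charFun μ t‖ = 1` would force `exp(ity)` to be almost surely constant.
  rcases ae_eq_const_or_norm_integral_lt_of_norm_le_const hle with hconst | hlt
  · exfalso
    set w := ⨍ y : ℝ, Complex.exp (t * y * Complex.I) ∂μ
    have h1 : ∀ᵐ p : ℝ × ℝ ∂(μ.prod μ), Complex.exp (t * p.1 * Complex.I) = w :=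
      Measure.quasiMeasurePreserving_fst.ae hconst
    have h2 : ∀ᵐ p : ℝ × ℝ ∂(μ.prod μ), Complex.exp (t * p.2 * Complex.I) = w :=
      Measure.quasiMeasurePreserving_snd.ae hconst
    have h3 : ∀ᵐ p : ℝ × ℝ ∂(μ.prod μ), p.1 = p.2 := by
      filter_upwards [ht, h1, h2] with p hp hp1 hp2
      apply hp
      have : ((t * (p.1 - p.2) : ℝ) : ℂ) * Complex.I =
          t * p.1 * Complex.I - t * p.2 * Complex.I := by push_cast; ring
      rw [this, Complex.exp_sub, hp1, ← hp2, div_self (Complex.exp_ne_zero _)]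
    obtain ⟨c, hc⟩ := (Measure.ae_ae_of_ae_prod h3).exists
    exact hμ c (by filter_upwards [hc] with y hy using hy.symm)
  · simpa using hlt

/-- Sums of i.i.d. non-degenerate real random variables leave every bounded set. -/
theorem tendsto_measure_abs_sum_le_zero {Ω : Type*} [MeasurableSpace Ω]
    (P : Measure Ω) [IsProbabilityMeasure P] {Y : ℕ → Ω → ℝ} (hY : ∀ i, Measurable (Y i))
    (hind : iIndepFun Y P) {μ : Measure ℝ} (hμ : ∀ i, P.map (Y i) = μ)
    (hnd : ∀ c : ℝ, ¬ ∀ᵐ y ∂μ, y = c) (M : ℝ) :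
    Tendsto (fun n : ℕ => P {ω | |∑ i : Fin n, Y i ω| ≤ M}) atTop (𝓝 0) := by
  have hmp : IsProbabilityMeasure μ := hμ 0 ▸ Measure.isProbabilityMeasure_map (hY 0).aemeasurable
  have hlim : Tendsto (fun n : ℕ => ∫ t, ‖charFun μ t‖ ^ n ∂(gaussianReal 0 1)) atTop (𝓝 0) := by
    have : NullSingletonClass (gaussianReal 0 1) := nullSingletonClass_gaussianReal one_ne_zero
    have hm : Measurable (charFun μ) := measurable_charFun
    have := tendsto_integral_of_dominated_convergence (μ := gaussianReal 0 1)
      (F := fun (n : ℕ) t => ‖charFun μ t‖ ^ n) (f := fun _ => 0) (fun _ => 1)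
      (fun n => (hm.norm.pow_const n).aestronglyMeasurable) (integrable_const 1)
      (fun n => ae_of_all _ fun t => by
        rw [Real.norm_of_nonneg (by positivity)]
        exact pow_le_one₀ (norm_nonneg _) (norm_charFun_le_one t))
      (by
        filter_upwards [ae_norm_charFun_lt_one μ hnd (gaussianReal 0 1)] with t ht
        exact tendsto_pow_atTop_nhds_zero_of_lt_one (norm_nonneg _) ht)
    simpa using this
  have hlim' := ENNReal.tendsto_ofReal (hlim.const_mul (Real.exp (M ^ 2 / 2)))
  rw [mul_zero, ENNReal.ofReal_zero] at hlim'
  refine tendsto_of_tendsto_of_tendsto_of_le_of_le tendsto_const_nhds hlim'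
    (fun _ => zero_le) fun n => ?_
  refine (measure_abs_le_le_integral_norm_charFun P
    (Z := fun ω => ∑ i : Fin n, Y i ω)
    (Finset.measurable_fun_sum _ fun i _ => hY i) M).trans_eq ?_
  have hind' : iIndepFun (fun i : Fin n => Y i) P := hind.precomp Fin.val_injective
  rw [hind'.charFun_map_fun_sum_eq_prod fun i : Fin n => (hY i).aemeasurable]
  simp [hμ]

theorem likelihood_expFamilyDensity {S : Type*} (h T : S → ℝ) (u v : ℝ → ℝ) {n : ℕ}
    (x : Fin n → S) (θ : ℝ) :
    likelihood (expFamilyDensity h T u v) x θ =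
      (∏ i, h (x i)) * Real.exp (u θ * ∑ i, T (x i) - n * v θ) := by
  simp only [likelihood, expFamilyDensity]
  rw [Finset.prod_mul_distrib, ← Real.exp_sum, Finset.sum_sub_distrib, Finset.mul_sum]
  simp

theorem isUnimodalOn_likelihood_expFamilyDensity {S : Type*} {h T : S → ℝ}
    (hh_nonneg : ∀ x, 0 ≤ h x) {Θ : Set ℝ} (hΘ : Θ.OrdConnected) {u v u' : ℝ → ℝ}
    (hu : ∀ θ ∈ Θ, HasDerivWithinAt u (u' θ) Θ θ)
    (hv : ∀ θ ∈ Θ, HasDerivWithinAt v (θ * u' θ) Θ θ)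
    (hu' : ∀ θ ∈ Θ, 0 < u' θ) {n : ℕ} (hn : 0 < n) (x : Fin n → S) :
    IsUnimodalOn (fun θ => likelihood (expFamilyDensity h T u v) x θ) Θ := by
  have hn' : (0 : ℝ) < n := Nat.cast_pos.2 hn
  have hH : 0 ≤ ∏ i, h (x i) := Finset.prod_nonneg fun i _ => hh_nonneg _
  set t := ∑ i, T (x i) with ht
  have hderiv : ∀ D ⊆ Θ, ∀ θ ∈ D,
      HasDerivWithinAt (fun θ => u θ * t - n * v θ) (u' θ * (t - n * θ)) D θ := by
    intro D hD θ hθ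
    have := ((((hu θ (hD hθ)).mul_const t).sub ((hv θ (hD hθ)).const_mul (n : ℝ)))).mono hD
    exact this.congr_deriv (by ring)
  have hconv : ∀ D : Set ℝ, D.OrdConnected → Convex ℝ D := fun D hD => hD.convex
  refine ⟨t / n, ?_, ?_⟩
  · have hmono : MonotoneOn (fun θ => u θ * t - n * v θ) (Θ ∩ Set.Iic (t / n)) := by
      refine monotoneOn_of_hasDerivWithinAt_nonneg (hconv _ (hΘ.inter Set.ordConnected_Iic))
        (fun θ hθ => (hderiv _ Set.inter_subset_left θ hθ).continuousWithinAt)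
        (fun θ hθ => hderiv _ (interior_subset.trans Set.inter_subset_left) θ hθ) ?_
      intro θ hθ
      obtain ⟨h1, h2⟩ := interior_subset hθ
      have h3 := (le_div_iff₀ hn').1 h2
      exact mul_nonneg (hu' θ h1).le (by linarith)
    intro a ha b hb hab
    simp only [likelihood_expFamilyDensity, ← ht]
    exact mul_le_mul_of_nonneg_left (Real.exp_le_exp.2 (hmono ha hb hab)) hH
  · have hanti : AntitoneOn (fun θ => u θ * t - n * v θ) (Θ ∩ Set.Ici (t / n)) := by
      refine antitoneOn_of_hasDerivWithinAt_nonpos (hconv _ (hΘ.inter Set.ordConnected_Ici))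
        (fun θ hθ => (hderiv _ Set.inter_subset_left θ hθ).continuousWithinAt)
        (fun θ hθ => hderiv _ (interior_subset.trans Set.inter_subset_left) θ hθ) ?_
      intro θ hθ
      obtain ⟨h1, h2⟩ := interior_subset hθ
      have h3 := (div_le_iff₀ hn').1 h2
      exact mul_nonpos_of_nonneg_of_nonpos (hu' θ h1).le (by linarith)
    intro a ha b hb hab
    simp only [likelihood_expFamilyDensity, ← ht]
    exact mul_le_mul_of_nonneg_left (Real.exp_le_exp.2 (hanti ha hb hab)) hH

/-- The sufficient statistic of the family is not almost surely constant. -/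
theorem not_ae_eq_const_expFamily {S : Type*} [MeasurableSpace S] {ν : Measure S}
    {h T : S → ℝ} (hh : Measurable h) (hT : Measurable T) (hh_nonneg : ∀ x, 0 ≤ h x)
    {Θ : Set ℝ} (hΘ : Θ.OrdConnected) {u v u' : ℝ → ℝ}
    (hu : ∀ θ ∈ Θ, HasDerivWithinAt u (u' θ) Θ θ)
    (hv : ∀ θ ∈ Θ, HasDerivWithinAt v (θ * u' θ) Θ θ)
    (hu' : ∀ θ ∈ Θ, 0 < u' θ)
    (hprob : ∀ θ ∈ Θ, IsProbabilityMeasure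
      (ν.withDensity fun x => ENNReal.ofReal (expFamilyDensity h T u v θ x)))
    {θ₁ θ₂ : ℝ} (h₁ : θ₁ ∈ Θ) (h₂ : θ₂ ∈ Θ) (h₁₂ : θ₁ < θ₂) (θ τ : ℝ) :
    ¬ ∀ᵐ x ∂(ν.withDensity fun x => ENNReal.ofReal (expFamilyDensity h T u v θ x)), T x = τ := by
  intro hconst
  have hmeas : ∀ η, Measurable fun x => ENNReal.ofReal (expFamilyDensity h T u v η x) := by
    intro η
    unfold expFamilyDensity
    fun_prop
  -- The density vanishes exactly where `h` does, whatever the parameter, so `T = τ` transfers from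
  -- `θ` to every `η`.
  rw [ae_withDensity_iff (hmeas θ)] at hconst
  have hsub : Set.Icc θ₁ θ₂ ⊆ Θ := hΘ.out h₁ h₂
  set K := ∫⁻ x, ENNReal.ofReal (h x) ∂ν
  have hK : ∀ η ∈ Θ, K * ENNReal.ofReal (Real.exp (u η * τ - v η)) = 1 := by
    intro η hη
    have h1 := (hprob η hη).measure_univ
    rw [withDensity_apply _ MeasurableSet.univ, Measure.restrict_univ] at h1
    rw [← h1, ← lintegral_mul_const _ (by fun_prop)]
    refine lintegral_congr_ae ?_
    filter_upwards [hconst] with x hx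
    rw [← ENNReal.ofReal_mul (hh_nonneg x)]
    rcases (hh_nonneg x).eq_or_lt with h0 | h0
    · simp [expFamilyDensity, ← h0]
    · have : T x = τ := hx (by
        rw [ENNReal.ofReal_ne_zero_iff]
        exact mul_pos h0 (Real.exp_pos _))
      simp [expFamilyDensity, this]
  have hg : ∀ η ∈ Set.Icc θ₁ θ₂, u η * τ - v η = u θ₁ * τ - v θ₁ := by
    intro η hη
    have e1 := hK η (hsub hη)
    have e2 := hK θ₁ h₁
    have hK0 : K ≠ 0 := by rintro h0; simp [h0] at e1
    have hKt : K ≠ ⊤ := by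
      rintro h0
      rw [h0, ENNReal.top_mul (ENNReal.ofReal_ne_zero_iff.2 (Real.exp_pos _))] at e1
      exact ENNReal.top_ne_one e1
    have e3 := (ENNReal.mul_right_inj hK0 hKt).1 (e1.trans e2.symm)
    rw [ENNReal.ofReal_eq_ofReal_iff (Real.exp_pos _).le (Real.exp_pos _).le] at e3
    exact Real.exp_injective e3
  have hτ : ∀ η ∈ Set.Icc θ₁ θ₂, τ = η := by
    intro η hη
    have hd := (((hu η (hsub hη)).mul_const τ).sub (hv η (hsub hη))).mono hsub
    have hd0 : HasDerivWithinAt (fun η => u η * τ - v η) 0 (Set.Icc θ₁ θ₂) η :=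
      (hasDerivWithinAt_const η _ (u θ₁ * τ - v θ₁)).congr hg (hg η hη)
    have := (uniqueDiffOn_Icc h₁₂ η hη).eq_deriv _ hd hd0
    have hpos := hu' η (hsub hη)
    have : u' η * (τ - η) = 0 := by linarith
    rcases mul_eq_zero.1 this with h0 | h0
    · exact absurd h0 hpos.ne'
    · linarith
  have e1 := hτ θ₁ (Set.left_mem_Icc.2 h₁₂.le)
  have e2 := hτ θ₂ (Set.right_mem_Icc.2 h₁₂.le)
  linarith

theorem tendsto_measure_likelihoodRatioBetween {Ω S : Type*} [MeasurableSpace Ω]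
    [MeasurableSpace S] {ν : Measure S} {h T : S → ℝ} (hT : Measurable T)
    (hh_nonneg : ∀ x, 0 ≤ h x) {u v : ℝ → ℝ} {f : S → ℝ} {P : Measure Ω} {X : ℕ → Ω → S}
    (hX : IsIIDSample ν f X P)
    (hnd : ∀ τ : ℝ, ¬ ∀ᵐ x ∂(ν.withDensity fun x => ENNReal.ofReal (f x)), T x = τ)
    {θ₁ θ₂ : ℝ} (hu : u θ₁ < u θ₂) {lo hi : ℝ} (hlo : 0 < lo) (hhi : 0 < hi) :
    Tendsto (fun n : ℕ => P {ω | LikelihoodRatioBetween (expFamilyDensity h T u v)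
      (fun i : Fin n => X i ω) θ₁ θ₂ lo hi}) atTop (𝓝 0) := by
  have := hX.isProbabilityMeasure
  set g : S → ℝ := fun x => (u θ₂ - u θ₁) * T x - (v θ₂ - v θ₁) with hg
  have hgm : Measurable g := by fun_prop
  have hlim := tendsto_measure_abs_sum_le_zero P (Y := fun i ω => g (X i ω))
    (fun i => hgm.comp (hX.measurable i)) (hX.iIndepFun.comp (fun _ => g) fun _ => hgm)
    (μ := (ν.withDensity fun x => ENNReal.ofReal (f x)).map g)
    (fun i => by rw [← hX.map_eq i, Measure.map_map hgm (hX.measurable i)]; rfl)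
    (fun c hc => by
      have hc := ae_of_ae_map hgm.aemeasurable hc
      refine hnd ((c + (v θ₂ - v θ₁)) / (u θ₂ - u θ₁)) ?_
      filter_upwards [hc] with x hx
      rw [eq_div_iff (sub_pos.2 hu).ne', ← hx, hg]
      ring)
    (max |Real.log lo| |Real.log hi|)
  refine tendsto_of_tendsto_of_tendsto_of_le_of_le tendsto_const_nhds hlim
    (fun _ => zero_le) fun n => measure_mono fun ω hω => ?_
  obtain ⟨h1, h2⟩ := hω
  rw [likelihood_expFamilyDensity, likelihood_expFamilyDensity] at h1 h2
  set H := ∏ i : Fin n, h (X i ω)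
  have hH : 0 ≤ H := Finset.prod_nonneg fun i _ => hh_nonneg _
  set a := u θ₁ * ∑ i : Fin n, T (X i ω) - n * v θ₁ with ha
  set b := u θ₂ * ∑ i : Fin n, T (X i ω) - n * v θ₂ with hb
  have hsum : ∑ i : Fin n, g (X i ω) = b - a := by
    simp only [hg, Finset.sum_sub_distrib, ← Finset.mul_sum, Finset.sum_const, Finset.card_univ,
      Fintype.card_fin, nsmul_eq_mul, ha, hb]
    ring
  -- `H` may be zero in general, but the strict inequality excludes it, so `0 ≤ H` suffices to
  -- cancel.
  have hlo' : Real.log lo < b - a := by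
    have h3 : lo * Real.exp a < Real.exp b :=
      lt_of_mul_lt_mul_left (by linarith [mul_left_comm H lo (Real.exp a)]) hH
    rw [← Real.exp_log hlo, ← Real.exp_add, Real.exp_lt_exp] at h3
    linarith
  have hhi' : b - a < Real.log hi := by
    have h3 : Real.exp b < hi * Real.exp a :=
      lt_of_mul_lt_mul_left (by linarith [mul_left_comm H hi (Real.exp a)]) hH
    rw [← Real.exp_log hhi, ← Real.exp_add, Real.exp_lt_exp] at h3
    linarith
  change |∑ i : Fin n, g (X i ω)| ≤ _
  rw [hsum, abs_le]
  constructor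
  · linarith [neg_abs_le (Real.log lo), le_max_left |Real.log lo| |Real.log hi|]
  · linarith [le_abs_self (Real.log hi), le_max_right |Real.log lo| |Real.log hi|]

theorem theorem8 {Ω S : Type*} [MeasurableSpace Ω] [MeasurableSpace S]
    (ν : MeasureTheory.Measure S)
    (h T : S → ℝ) (hh : Measurable h) (hT : Measurable T) (hh_nonneg : ∀ x, 0 ≤ h x)
    (Θ : Set ℝ) (hΘ : Θ.OrdConnected)
    (u v u' : ℝ → ℝ)
    (hu : ∀ θ ∈ Θ, HasDerivWithinAt u (u' θ) Θ θ)
    (hv : ∀ θ ∈ Θ, HasDerivWithinAt v (θ * u' θ) Θ θ)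
    (hu' : ∀ θ ∈ Θ, 0 < u' θ)
    (P : ℝ → MeasureTheory.Measure Ω) (X : ℕ → Ω → S)
    (hX : ∀ θ ∈ Θ, IsIIDSample ν (expFamilyDensity h T u v θ) X (P θ)) :
    (∀ n : ℕ, 0 < n → ∀ x : Fin n → S,
      IsUnimodalOn (fun θ => likelihood (expFamilyDensity h T u v) x θ) Θ) ∧
    (∀ α ∈ Set.Ioo (0 : ℝ) 1, ∀ β ∈ Set.Ioo (0 : ℝ) 1,
      ∀ θ ∈ Θ, ∀ θ₁ ∈ Θ, ∀ θ₂ ∈ Θ, θ₁ < θ₂ →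
      Filter.Tendsto
        (fun n : ℕ => P θ {ω | LikelihoodRatioBetween (expFamilyDensity h T u v)
          (fun i : Fin n => X i ω) θ₁ θ₂ β (1 / α)})
        Filter.atTop (nhds 0)) := by
  refine ⟨fun n hn x => isUnimodalOn_likelihood_expFamilyDensity hh_nonneg hΘ hu hv hu' hn x, ?_⟩
  intro α hα β hβ θ hθ θ₁ h₁ θ₂ h₂ h₁₂
  have hprob : ∀ η ∈ Θ, IsProbabilityMeasure
      (ν.withDensity fun x => ENNReal.ofReal (expFamilyDensity h T u v η x)) := by
    intro η hη
    have := (hX η hη).isProbabilityMeasure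
    rw [← (hX η hη).map_eq 0]
    exact Measure.isProbabilityMeasure_map ((hX η hη).measurable 0).aemeasurable
  have hmono : StrictMonoOn u Θ :=
    strictMonoOn_of_hasDerivWithinAt_pos hΘ.convex
      (fun η hη => (hu η hη).continuousWithinAt)
      (fun η hη => (hu η (interior_subset hη)).mono interior_subset)
      fun η hη => hu' η (interior_subset hη)
  exact tendsto_measure_likelihoodRatioBetween hT hh_nonneg (hX θ hθ)
    (not_ae_eq_const_expFamily hh hT hh_nonneg hΘ hu hv hu' hprob h₁ h₂ h₁₂ θ)
    (hmono h₁ h₂ h₁₂) hβ.1 (one_div_pos.2 hα.1)
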